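/- Let $L\subset\mathbb R^n$ be an affine subspace and let $l_1,\dots,l_k:\mathbb R^n\to\mathbb R$ be affine functions (polynomials of degree at most $1$). Put $$X=\{x\in L \mid l_i(x)\ge 0 \text{ for } i=1,\dots,k\},\qquad X_\epsilon=\Big\{x\in X \;\Big|\; \prod_{i=1}^k l_i(x)\ge\epsilon\Big\}\quad(\epsilon>0).$$ Then $X$ is convex, and $X_\epsilon$ is convex for every $\epsilon>0$. Moreover there is $\epsilon_0>0$ such that for every $0<\epsilon<\epsilon_0$ the set $X_\epsilon$ is a (possibly empty) $C^\infty$ embedded submanifold of $L$ of dimension $\dim L$, possibly with boundary; that is, every point of $X_\epsilon$ lies in the domain of a $C^\infty$ chart of $L$ in which $X_\epsilon$ corresponds either to the whole model space or to a closed linear half-space. -/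

import Mathlib

open scoped Manifold ContDiff

noncomputable section

namespace ConvexSmoothing

section AffineSubspaceManifold

variable {E : Type*} [NormedAddCommGroup E] [NormedSpace ℝ E]

/-- The global chart `x ↦ x - p` of an affine subspace `L`, with values in its direction,
centred at a point `p` of `L`. -/
def affineChart (L : AffineSubspace ℝ E) (p : L) : OpenPartialHomeomorph L L.direction :=
  haveI : Nonempty L := ⟨p⟩
  (IsometryEquiv.vaddConst p).symm.toHomeomorph.toOpenPartialHomeomorph

theorem affineChart_apply (L : AffineSubspace ℝ E) (p x : L) :
    (affineChart L p x : E) = (x : E) - (p : E) := by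
  rfl

theorem affineChart_symm_apply (L : AffineSubspace ℝ E) (p : L) (v : L.direction) :
    (((affineChart L p).symm v : L) : E) = (v : E) + (p : E) := by
  rfl

/-- The standard smooth structure of an affine subspace: its charts are `x ↦ x - p`, `p ∈ L`. -/
instance affineChartedSpace (L : AffineSubspace ℝ E) : ChartedSpace L.direction L where
  atlas := Set.range (affineChart L)
  chartAt p := affineChart L p
  mem_chart_source p := Set.mem_univ p
  chart_mem_atlas p := Set.mem_range_self p

instance affineIsManifold (L : AffineSubspace ℝ E) :
    IsManifold 𝓘(ℝ, L.direction) ∞ L := by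
  apply isManifold_of_contDiffOn
  rintro e e' ⟨p, rfl⟩ ⟨q, rfl⟩
  have hpq : (p : E) - (q : E) ∈ L.direction := L.vsub_mem_direction p.2 q.2
  have h : ContDiff ℝ ∞ (fun v : L.direction => v + ⟨(p : E) - (q : E), hpq⟩) :=
    contDiff_id.add contDiff_const
  refine h.contDiffOn.congr ?_
  intro v _
  apply Subtype.ext
  change ((v : E) + (p : E)) - (q : E) = (v : E) + ((p : E) - (q : E))
  abel

end AffineSubspaceManifold

/-- `S` is a `d`-dimensional smooth (embedded) submanifold, possibly with boundary, of the
boundaryless smooth manifold `M`: around each of its points there is a smooth chart of `M` in which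
`S` becomes a `d`-dimensional linear subspace `W`, or a closed half-space `{w ∈ W | 0 ≤ ℓ w}` of
such a subspace, where `ℓ` is a linear functional that does not vanish identically on `W`. -/
def IsSmoothSubmanifold {E : Type*} [NormedAddCommGroup E] [NormedSpace ℝ E]
    [FiniteDimensional ℝ E] {M : Type*} [TopologicalSpace M] [ChartedSpace E M]
    (d : ℕ) (S : Set M) : Prop :=
  ∀ p ∈ S, ∃ φ ∈ IsManifold.maximalAtlas 𝓘(ℝ, E) ∞ M, p ∈ φ.source ∧
    ∃ W : Submodule ℝ E, Module.finrank ℝ W = d ∧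
      ((∀ x ∈ φ.source, x ∈ S ↔ φ x ∈ W) ∨
        ∃ ℓ : E →ₗ[ℝ] ℝ, (∃ w ∈ W, ℓ w ≠ 0) ∧
          ∀ x ∈ φ.source, x ∈ S ↔ φ x ∈ W ∧ 0 ≤ ℓ (φ x))

/-- `X = {x ∈ L | l i x ≥ 0 for all i}`. -/
def polyhedron {n k : ℕ} (L : AffineSubspace ℝ (EuclideanSpace ℝ (Fin n)))
    (l : Fin k → (EuclideanSpace ℝ (Fin n) →ᵃ[ℝ] ℝ)) : Set (EuclideanSpace ℝ (Fin n)) :=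
  {x | x ∈ L ∧ ∀ i, 0 ≤ l i x}

/-- `X_ε = {x ∈ X | ∏ i, l i x ≥ ε}`. -/
def smoothing {n k : ℕ} (L : AffineSubspace ℝ (EuclideanSpace ℝ (Fin n)))
    (l : Fin k → (EuclideanSpace ℝ (Fin n) →ᵃ[ℝ] ℝ)) (ε : ℝ) :
    Set (EuclideanSpace ℝ (Fin n)) :=
  {x | x ∈ polyhedron L l ∧ ε ≤ ∏ i, l i x}

end ConvexSmoothing

end

open scoped Manifold ContDiff

namespace ConvexSmoothing

/-! Weighted AM-GM, applied to each factor, makes the product log-concave on `X`, so its superlevel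
sets are convex. For smoothness, suppose the product is positive at some `x` in `X`, and take its
value there as `ε₀`. If `0 < ε < ε₀`, then at a point of `X` where the product equals `ε` its
derivative towards `x` is positive (`sum_prod_erase_mul_sub_pos`). The level is thus regular, and
the inverse function theorem straightens it into a hyperplane
(`exists_mem_contDiffGroupoid_linearizing`). -/

theorem convex_polyhedron {n k : ℕ} (L : AffineSubspace ℝ (EuclideanSpace ℝ (Fin n)))
    (l : Fin k → (EuclideanSpace ℝ (Fin n) →ᵃ[ℝ] ℝ)) : Convex ℝ (polyhedron L l) := by
  have h : polyhedron L l = (L : Set _) ∩ ⋂ i, l i ⁻¹' Set.Ici 0 := by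
    ext x
    simp [polyhedron]
  rw [h]
  exact L.convex.inter (convex_iInter fun i => (convex_Ici 0).affine_preimage (l i))

theorem convex_smoothing {n k : ℕ} (L : AffineSubspace ℝ (EuclideanSpace ℝ (Fin n)))
    (l : Fin k → (EuclideanSpace ℝ (Fin n) →ᵃ[ℝ] ℝ)) {ε : ℝ} (hε : 0 < ε) :
    Convex ℝ (smoothing L l ε) := by
  rintro x ⟨hx, hxε⟩ y ⟨hy, hyε⟩ a b ha hb hab
  refine ⟨convex_polyhedron L l hx hy ha hb hab, ?_⟩
  have hX : 0 ≤ ∏ i, l i x := hε.le.trans hxε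
  calc ε = ε ^ a * ε ^ b := by rw [← Real.rpow_add hε, hab, Real.rpow_one]
    _ ≤ (∏ i, l i x) ^ a * (∏ i, l i y) ^ b := by gcongr
    _ = ∏ i, l i x ^ a * l i y ^ b := by
      rw [← Real.finsetProd_rpow _ _ fun i _ => hx.2 i, ← Real.finsetProd_rpow _ _ fun i _ => hy.2 i,
        Finset.prod_mul_distrib]
    _ ≤ ∏ i, l i (a • x + b • y) := by
      refine Finset.prod_le_prod
        (fun i _ => mul_nonneg (Real.rpow_nonneg (hx.2 i) a) (Real.rpow_nonneg (hy.2 i) b))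
        fun i _ => ?_
      rw [Convex.combo_affine_apply hab]
      exact Real.geom_mean_le_arith_mean2_weighted ha hb (hx.2 i) (hy.2 i) hab

/-- The derivative of a product of affine functions at a point where they are positive is positive
in the direction of a point where the product is larger. -/
theorem sum_prod_erase_mul_sub_pos {ι : Type*} [DecidableEq ι] (s : Finset ι) {a b : ι → ℝ}
    (ha : ∀ i ∈ s, 0 < a i) (hb : ∀ i ∈ s, 0 < b i) (hab : ∏ i ∈ s, a i < ∏ i ∈ s, b i) :
    0 < ∑ i ∈ s, (∏ j ∈ s.erase i, a j) * (b i - a i) := by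
  have hP : 0 < ∏ i ∈ s, a i := Finset.prod_pos ha
  -- Divided by `∏ a i`, the goal's sum is `∑ (b i / a i - 1)`, which `log t ≤ t - 1` bounds below
  -- by the log of the ratio of the products.
  have hlog : 0 < ∑ i ∈ s, Real.log (b i / a i) := by
    rw [← Real.log_prod fun i hi => (div_pos (hb i hi) (ha i hi)).ne', Finset.prod_div_distrib]
    exact Real.log_pos ((one_lt_div hP).2 hab)
  have hsum : 0 < ∑ i ∈ s, (b i / a i - 1) :=
    hlog.trans_le (Finset.sum_le_sum fun i hi =>
      Real.log_le_sub_one_of_pos (div_pos (hb i hi) (ha i hi)))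
  refine (mul_pos hP hsum).trans_eq ?_
  rw [Finset.mul_sum]
  refine Finset.sum_congr rfl fun i hi => ?_
  rw [← Finset.prod_erase_mul s a hi]
  have := (ha i hi).ne'
  field_simp

/-- Near a regular point, an analytic function becomes linear in a suitable chart. -/
theorem exists_mem_contDiffGroupoid_linearizing {E : Type*} [NormedAddCommGroup E]
    [NormedSpace ℝ E] [CompleteSpace E] {F : E → ℝ} {a v : E} {ℓ : E →L[ℝ] ℝ}
    (hF : ContDiffAt ℝ ω F a) (hℓ : HasFDerivAt F ℓ a) (hv : ℓ v ≠ 0) :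
    ∃ ψ ∈ contDiffGroupoid ∞ 𝓘(ℝ, E), a ∈ ψ.source ∧ ∀ y ∈ ψ.source, ℓ (ψ y) = F y := by
  -- The multiple of `v` is chosen to force `ℓ ∘ φ = F`; since `F - ℓ` has zero derivative at `a`,
  -- `φ` has derivative the identity there.
  let φ : E → E := fun y => y + ((ℓ v)⁻¹ * (F y - ℓ y)) • v
  have hφ : ContDiffAt ℝ ω φ a :=
    contDiffAt_id.add ((contDiffAt_const.mul (hF.sub ℓ.contDiff.contDiffAt)).smul contDiffAt_const)
  have hφ' : HasFDerivAt φ ((ContinuousLinearEquiv.refl ℝ E : E ≃L[ℝ] E) : E →L[ℝ] E) a := by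
    have h := (hasFDerivAt_id (𝕜 := ℝ) a).add
      (((hℓ.sub ℓ.hasFDerivAt).const_mul (ℓ v)⁻¹).smul_const v)
    refine h.congr_fderiv ?_
    ext w
    simp
  have hω : (ω : WithTop ℕ∞) ≠ 0 := by simp
  -- `ContDiffAt` of order `ω` spreads to a neighbourhood, while order `∞` need not; hence the later
  -- descent from `ω` to `∞`.
  have hω' : (ω : WithTop ℕ∞) ≠ ∞ := by simp
  let e := hφ.toOpenPartialHomeomorph φ hφ' hω
  have ha : a ∈ e.source := hφ.mem_toOpenPartialHomeomorph_source hφ' hω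
  refine ⟨e.restrContDiff ℝ ω hω', ?_, ?_, ?_⟩
  · rw [contDiffGroupoid, mem_groupoid_of_pregroupoid]
    constructor
    · simp only [contDiffPregroupoid, modelWithCornersSelf_coe, modelWithCornersSelf_coe_symm,
        Function.id_comp, Function.comp_id, Set.preimage_id, Set.range_id, Set.inter_univ]
      exact (e.contDiffOn_restrContDiff_source ℝ hω').of_le le_top
    · simp only [contDiffPregroupoid, modelWithCornersSelf_coe, modelWithCornersSelf_coe_symm,
        Function.id_comp, Function.comp_id, Set.preimage_id, Set.range_id, Set.inter_univ]
      exact (e.contDiffOn_restrContDiff_target ℝ hω').of_le le_top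
  · exact ⟨ha, hφ, hφ.to_localInverse hφ' hω⟩
  · intro y _
    change ℓ (y + ((ℓ v)⁻¹ * (F y - ℓ y)) • v) = F y
    rw [map_add, map_smul, smul_eq_mul]
    field_simp
    ring

theorem trans_mem_maximalAtlas {H M : Type*} [TopologicalSpace H] [TopologicalSpace M]
    [ChartedSpace H M] {G : StructureGroupoid H} [HasGroupoid M G] {e : OpenPartialHomeomorph M H}
    (he : e ∈ atlas H M) {ψ : OpenPartialHomeomorph H H} (hψ : ψ ∈ G) :
    e ≫ₕ ψ ∈ G.maximalAtlas M := by
  intro e' he'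
  constructor
  · rw [OpenPartialHomeomorph.trans_symm_eq_symm_trans_symm, OpenPartialHomeomorph.trans_assoc]
    exact G.trans (G.symm hψ) (G.compatible he he')
  · rw [← OpenPartialHomeomorph.trans_assoc]
    exact G.trans (G.compatible he' he) hψ

theorem isSmoothSubmanifold_smoothing {n k : ℕ} (L : AffineSubspace ℝ (EuclideanSpace ℝ (Fin n)))
    (l : Fin k → (EuclideanSpace ℝ (Fin n) →ᵃ[ℝ] ℝ)) {ε : ℝ} (hε : 0 < ε)
    {x : EuclideanSpace ℝ (Fin n)} (hx : x ∈ polyhedron L l) (hxε : ε < ∏ i, l i x) :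
    IsSmoothSubmanifold (E := L.direction) (M := L) (Module.finrank ℝ L.direction)
      {x : L | (x : EuclideanSpace ℝ (Fin n)) ∈ smoothing L l ε} := by
  have pos : ∀ y : EuclideanSpace ℝ (Fin n), (∀ i, 0 ≤ l i y) → 0 < ∏ i, l i y →
      ∀ i, 0 < l i y := fun y hy h i =>
    (hy i).lt_of_ne' (Finset.prod_ne_zero_iff.1 h.ne' i (Finset.mem_univ i))
  have hcont : ∀ i, Continuous fun y : L => l i y := fun i =>
    (l i).continuous_of_finiteDimensional.comp continuous_subtype_val
  rintro p ⟨⟨-, hp⟩, hpε⟩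
  have hp' := pos p hp (hε.trans_le hpε)
  -- Outside `X`, an even number of negative factors could also give a large product; on `U` the
  -- inequality on the product alone decides membership.
  let U : Set L := {y | ∀ i, 0 < l i y}
  have hU : IsOpen U := by
    simp only [U, Set.ofPred_forall]
    exact isOpen_iInter_of_finite fun i => isOpen_lt continuous_const (hcont i)
  have hmem : ∀ y ∈ U, (y : EuclideanSpace ℝ (Fin n)) ∈ smoothing L l ε ↔ ε ≤ ∏ i, l i y :=
    fun y hy => ⟨fun h => h.2, fun h => ⟨⟨y.2, fun i => (hy i).le⟩, h⟩⟩
  rcases hpε.lt_or_eq with hlt | heq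
  · let V : Set L := {y | ε < ∏ i, l i y}
    have hV : IsOpen V :=
      isOpen_lt continuous_const (continuous_finsetProd _ fun i _ => hcont i)
    refine ⟨(chartAt L.direction p).restr (U ∩ V),
      restr_mem_maximalAtlas _ (IsManifold.chart_mem_maximalAtlas p) (hU.inter hV), ?_,
      ⊤, finrank_top ℝ _, Or.inl fun y hy => ?_⟩
    · rw [OpenPartialHomeomorph.restr_source' _ _ (hU.inter hV)]
      exact ⟨mem_chart_source _ p, hp', hlt⟩
    · rw [OpenPartialHomeomorph.restr_source' _ _ (hU.inter hV)] at hy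
      simpa using (hmem y hy.2.1).2 hy.2.2.le
  · let A : Fin k → (L.direction →L[ℝ] ℝ) := fun i =>
      LinearMap.toContinuousLinearMap ((l i).linear.comp L.direction.subtype)
    have hA : ∀ i (v : L.direction), l i ((v : EuclideanSpace ℝ (Fin n)) + p) = A i v + l i p :=
      fun i v => (l i).map_vadd _ _
    let F : L.direction → ℝ := fun v => (∏ i, (A i v + l i p)) - ε
    have hF : ContDiff ℝ ω F :=
      (contDiff_prod fun i _ => (A i).contDiff.add contDiff_const).sub contDiff_const
    have hF' := ((HasFDerivAt.finsetProd (u := Finset.univ) (x := (0 : L.direction))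
      fun i _ => ((A i).hasFDerivAt.add_const (l i p))).sub_const ε)
    -- The transversal direction points from the boundary point `p` to `x`, where the product is
    -- larger.
    let v : L.direction := ⟨x - p, L.vsub_mem_direction hx.1 p.2⟩
    have hAv : ∀ i, A i v = l i x - l i p := fun i => by
      have h := hA i v
      rw [show ((v : EuclideanSpace ℝ (Fin n)) + p) = x from sub_add_cancel _ _] at h
      linarith
    have hv := sum_prod_erase_mul_sub_pos Finset.univ (fun i _ => hp' i)
      (fun i _ => pos x hx.2 (hε.trans hxε) i) (heq ▸ hxε)
    obtain ⟨ℓ, hℓ, hℓv⟩ : ∃ ℓ : L.direction →L[ℝ] ℝ, HasFDerivAt F ℓ 0 ∧ ℓ v ≠ 0 :=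
      ⟨_, hF', by simpa [hAv] using hv.ne'⟩
    obtain ⟨ψ, hψ, h0, hlin⟩ :=
      exists_mem_contDiffGroupoid_linearizing hF.contDiffAt hℓ hℓv
    have hψM : chartAt L.direction p ≫ₕ ψ ∈ IsManifold.maximalAtlas 𝓘(ℝ, L.direction) ∞ L :=
      trans_mem_maximalAtlas (chart_mem_atlas _ p) hψ
    refine ⟨(chartAt L.direction p ≫ₕ ψ).restr U, restr_mem_maximalAtlas _ hψM hU, ?_,
      ⊤, finrank_top ℝ _, Or.inr ⟨ℓ, ⟨v, trivial, hℓv⟩, fun y hy => ?_⟩⟩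
    · rw [OpenPartialHomeomorph.restr_source' _ _ hU, OpenPartialHomeomorph.trans_source]
      refine ⟨⟨mem_chart_source _ p, ?_⟩, hp'⟩
      have hp0 : chartAt L.direction p p = 0 := Subtype.ext (sub_self _)
      rwa [Set.mem_preimage, hp0]
    · rw [OpenPartialHomeomorph.restr_source' _ _ hU, OpenPartialHomeomorph.trans_source] at hy
      have hFy : F (chartAt L.direction p y) = (∏ i, l i y) - ε := by
        simp only [F, ← hA]
        rw [show ((chartAt L.direction p y : EuclideanSpace ℝ (Fin n)) + p) = y from
          sub_add_cancel _ _]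
      have hy' := (hlin _ hy.1.2).trans hFy
      change _ ↔ _ ∧ 0 ≤ ℓ (ψ (chartAt L.direction p y))
      rw [hy', sub_nonneg]
      simpa using hmem y hy.2

end ConvexSmoothing

theorem mainTheorem7 (n k : ℕ) (L : AffineSubspace ℝ (EuclideanSpace ℝ (Fin n)))
    (l : Fin k → (EuclideanSpace ℝ (Fin n) →ᵃ[ℝ] ℝ)) :
    Convex ℝ (ConvexSmoothing.polyhedron L l) ∧
    (∀ ε : ℝ, 0 < ε → Convex ℝ (ConvexSmoothing.smoothing L l ε)) ∧
    (∃ ε₀ : ℝ, 0 < ε₀ ∧ ∀ ε : ℝ, 0 < ε → ε < ε₀ →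
      ConvexSmoothing.IsSmoothSubmanifold (E := L.direction) (M := L)
        (Module.finrank ℝ L.direction)
        {x : L | (x : EuclideanSpace ℝ (Fin n)) ∈ ConvexSmoothing.smoothing L l ε}) := by
  refine ⟨ConvexSmoothing.convex_polyhedron L l,
    fun ε hε => ConvexSmoothing.convex_smoothing L l hε, ?_⟩
  by_cases h : ∃ x ∈ ConvexSmoothing.polyhedron L l, 0 < ∏ i, l i x
  · obtain ⟨x, hx, hpos⟩ := h
    exact ⟨_, hpos, fun ε hε hlt => ConvexSmoothing.isSmoothSubmanifold_smoothing L l hε hx hlt⟩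
  -- Here every `X_ε` is empty, so any positive `ε₀` serves.
  · exact ⟨1, one_pos, fun ε hε _ p hp => (h ⟨p, hp.1, hε.trans_le hp.2⟩).elim⟩
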